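/- Let $\mathcal S,\mathcal A,\mathcal R$ be finite sets of states, actions and rewards, $S:=|\mathcal S|$, $A:=|\mathcal A|$, let $M\ge 1$, $d:=2M-1$, and let $H>2M$ be the horizon. A latent MDP (LMDP) model $\theta=\{(w_m,\mu_m,T_m,R_m)\}_{m=1}^M$ consists of mixing weights $w_m\ge 0$ with $\sum_m w_m=1$ and, for every context $m\in[M]$, an initial state distribution $\mu_m$ on $\mathcal S$, transition probabilities $T_m(\cdot\mid s,a)$ on $\mathcal S$ and reward probabilities $R_m(\cdot\mid s,a)$ on $\mathcal R$. A (history-dependent) policy $\pi\in\Pi$ consists of a probability space $(\Xi,\rho)$ and action distributions $\pi_t(\cdot\mid \xi,(s_i,a_i,r_i)_{i<t},s_t)$ on $\mathcal A$, $t\in[H]$, measurable in $\xi\in\Xi$, where the seed $\xi\sim\rho$ is drawn at the beginning of the episode independently of the context, the states and the rewards. A memoryless policy $\psi\in\Pi_{\mathrm{mls}}$ consists of action distributions $\psi_t(\cdot\mid s_t)$ that depend only on $t\in[H]$ and $s_t\in\mathcal S$. Let $\mathbb P_\theta^\pi$ be the distribution of the trajectory $\mathcal T=(s_t,a_t,r_t)_{t=1}^H$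 when $\pi$ is executed in $\theta$, with the context $m$ not observed: $$\mathbb P_\theta^\pi(\mathcal T)=\sum_{m=1}^M w_m\int_\Xi \prod_{t=1}^H P_{m,t}(s_t)\,\pi_t\big(a_t\mid\xi,(s_i,a_i,r_i)_{i<t},s_t\big)\,R_m(r_t\mid s_t,a_t)\,d\rho(\xi),$$ where $P_{m,1}(s_1)=\mu_m(s_1)$ and $P_{m,t}(s_t)=T_m(s_t\mid s_{t-1},a_{t-1})$ for $t\ge 2$. Let $\mathrm{TV}$ denote the total variation distance. Let $\theta_1,\theta_2$ be two LMDP models with the same $\mathcal S,\mathcal A,\mathcal R,M$, let $\epsilon_{\mathrm{test}}\in\mathbb R$, and suppose that $$\mathrm{TV}\big(\mathbb P_{\theta_1}^{\psi},\mathbb P_{\theta_2}^{\psi}\big)\le\epsilon_{\mathrm{test}}\qquad\text{for every memoryless policy }\psi\in\Pi_{\mathrm{mls}}.$$ Then for every history-dependent policy $\pi\in\Pi$, $$\mathrm{TV}\big(\mathbb P_{\theta_1}^{\pi},\mathbb P_{\theta_2}^{\pi}\big)\le M\,(2H^2)^d\,(MSA)^d\,\epsilon_{\mathrm{test}}.$$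 -/

import Mathlib

open MeasureTheory

/-- A latent Markov decision process with `M` latent contexts, on states `S`, actions `A` and
rewards `R`. Context `m` is drawn with probability `weight m` at the start of an episode and stays
fixed; the episode then follows the time-homogeneous MDP with initial state distribution `init m`,
transition kernel `trans m` and reward kernel `reward m`.
The elements of `stdSimplex ℝ X` are the probability vectors on the finite type `X`. -/
structure LMDP (S A R : Type*) [Fintype S] [Fintype R] (M : ℕ) where
  weight : stdSimplex ℝ (Fin M)
  init : Fin M → stdSimplex ℝ S
  trans : Fin M → S → A → stdSimplex ℝ S
  reward : Fin M → S → A → stdSimplex ℝ R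

/-- Trajectories `(s_t, a_t, r_t)` of horizon `H`. Time steps are numbered `0, …, H - 1`. -/
abbrev Trajectory (S A R : Type*) (H : ℕ) := Fin H → S × A × R

namespace Trajectory

variable {S A R : Type*} {H : ℕ}

/-- The state at time `t`. -/
def state (T : Trajectory S A R H) (t : Fin H) : S := (T t).1

/-- The action at time `t`. -/
def action (T : Trajectory S A R H) (t : Fin H) : A := (T t).2.1

/-- The reward at time `t`. -/
def rew (T : Trajectory S A R H) (t : Fin H) : R := (T t).2.2

/-- The triples `(s, a, r)` at the time steps strictly before `t`. -/
def past (T : Trajectory S A R H) (t : Fin H) : Fin (t : ℕ) → S × A × R :=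
  fun i => T ⟨i, i.isLt.trans t.isLt⟩

end Trajectory

/-- A history-dependent policy. A seed in `Ξ` is drawn from `seed` at the beginning of the episode,
independently of everything else; at time `t`, the action is drawn from a distribution that
depends on the seed, on the triples `(s, a, r)` before time `t` and on the current state. -/
structure Policy (Ξ S A R : Type*) [MeasurableSpace Ξ] [Fintype A] (H : ℕ) where
  seed : ProbabilityMeasure Ξ
  act : Ξ → (t : Fin H) → (Fin (t : ℕ) → S × A × R) → S → stdSimplex ℝ A
  measurable_act : ∀ (t : Fin H) (h : Fin (t : ℕ) → S × A × R) (s : S) (a : A),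
    Measurable fun ξ => act ξ t h s a

/-- A memoryless policy: the action distribution depends only on the time and the current state. -/
def MemorylessPolicy (S A : Type*) [Fintype A] (H : ℕ) := Fin H → S → stdSimplex ℝ A

/-- A memoryless policy as a history-dependent policy (with a trivial seed). -/
noncomputable def MemorylessPolicy.toPolicy {S A : Type*} [Fintype A] {H : ℕ}
    (ψ : MemorylessPolicy S A H) (R : Type*) : Policy Unit S A R H where
  seed := ⟨Measure.dirac (), inferInstance⟩
  act _ t _ s := ψ t s
  measurable_act _ _ _ _ := measurable_const

namespace LMDP

variable {Ξ S A R : Type*} [MeasurableSpace Ξ] [Fintype S] [Fintype A] [Fintype R] {M H : ℕ}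

/-- The conditional probability, in context `m`, of the state of `T` at time `t` given what
precedes it in `T`: the initial distribution at the first step, the transition kernel later. -/
def stateProb (θ : LMDP S A R M) (m : Fin M) (T : Trajectory S A R H) : Fin H → ℝ
  | ⟨0, h⟩ => θ.init m (T.state ⟨0, h⟩)
  | ⟨t + 1, h⟩ =>
      θ.trans m (T.state ⟨t, (Nat.lt_succ_self t).trans h⟩)
        (T.action ⟨t, (Nat.lt_succ_self t).trans h⟩) (T.state ⟨t + 1, h⟩)

/-- The probability mass function of the trajectory when policy `π` is executed in `θ`. -/
noncomputable def trajProb (θ : LMDP S A R M) (π : Policy Ξ S A R H)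
    (T : Trajectory S A R H) : ℝ :=
  ∑ m : Fin M, θ.weight m *
    ∫ ξ, ∏ t : Fin H,
      (θ.stateProb m T t *
        π.act ξ t (T.past t) (T.state t) (T.action t) *
        θ.reward m (T.state t) (T.action t) (T.rew t)) ∂(π.seed : Measure Ξ)

end LMDP

/-- Total variation distance between two probability mass functions on a finite type. -/
noncomputable def tvDist {X : Type*} [Fintype X] (p q : X → ℝ) : ℝ :=
  (1 / 2) * ∑ x, |p x - q x|

/-!
Put the contexts of both models side by side, so that every path carries a vector of `M₁ + M₂`
likelihoods. Twice the total variation distance is the sum over all paths, weighted by the policy,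
of a seminorm of this vector, and contexts can be eliminated from the seminorm one at a time.

To eliminate the context `N`, play optimally for the payoff in `N`, and let `ρ j s k` be the
expected payoff in the context `k` from the state `s` at time `j` on. Replacing the likelihoods `v`
at time `j` by the predictions `v * ρ j s`, one compares time `j` with time `j + 1`. A single action
spreads `v * ρ j s` over its outcomes; subtracting from each outcome the multiple of `v * ρ j s`
that is correct in `N` leaves a residual that vanishes in `N`. By optimality these multiples add up
to at most `1`, so any policy gains at most the residuals. For the same reason, the residuals of a
fixed action at a fixed time and state are bounded by the predictions before and after this action,
that is, by twice the bound for deterministic memoryless policies. Hence induction applies to each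
of them, and there are `|S| |A|` for every time. At time `0` there is no history yet, so the first
step costs nothing, and every context after the first contributes a factor of at most
`1 + 2 * (H - 1) * |S| * |A|`, hence of at most `2 * H * |S| * |A|`.
-/

theorem sum_eq_sum_snoc {X β : Type*} [Fintype X] [AddCommMonoid β] {n : ℕ}
    (F : (Fin (n + 1) → X) → β) :
    ∑ T, F T = ∑ T : Fin n → X, ∑ x, F (Fin.snoc T x : Fin (n + 1) → X) := by
  rw [← (Fin.snocEquiv fun _ => X).sum_comp, Fintype.sum_prod_type, Finset.sum_comm]
  rfl

theorem geom_sum_le_one_add_pow {α : Type*} [CommSemiring α] [PartialOrder α]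
    [IsOrderedRing α] {x : α} (hx : 0 ≤ x) (n : ℕ) :
    ∑ i ∈ Finset.range (n + 1), x ^ i ≤ (1 + x) ^ n := by
  induction n with
  | zero => simp
  | succ n ih =>
    calc ∑ i ∈ Finset.range (n + 2), x ^ i
        = x * ∑ i ∈ Finset.range (n + 1), x ^ i + 1 := geom_sum_succ
      _ ≤ x * (1 + x) ^ n + (1 + x) ^ n := by
        gcongr
        exact one_le_pow₀ (le_add_of_nonneg_right hx)
      _ = (1 + x) ^ (n + 1) := by ring

theorem le_mul_pow_mul_pow_mul_of_le_pow_mul {x ε s a m h : ℝ} {d : ℕ} (hx : 0 ≤ x) (hm : 1 ≤ m)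
    (hh : 1 ≤ h) (hle : x ≤ (2 * h * s * a) ^ d * ε) :
    x ≤ m * (2 * h ^ 2) ^ d * (m * s * a) ^ d * ε :=
  calc x ≤ (2 * h * s * a) ^ d * ε := hle
    _ ≤ m * (h * m) ^ d * ((2 * h * s * a) ^ d * ε) :=
        le_mul_of_one_le_left (hx.trans hle) (one_le_mul_of_one_le_of_one_le hm
          (one_le_pow₀ (one_le_mul_of_one_le_of_one_le hh hm)))
    _ = m * (2 * h ^ 2) ^ d * (m * s * a) ^ d * ε := by
        simp only [mul_pow]
        ring

theorem nonempty_of_stdSimplex {X : Type*} [Fintype X] (p : stdSimplex ℝ X) : Nonempty X :=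
  not_isEmpty_iff.1 fun _ => by simpa using p.2.2

section Seminorm

variable {E O : Type*} [Fintype O]

theorem seminorm_sum_le [AddCommGroup E] [Module ℝ E] (p : Seminorm ℝ E) (x : O → E) :
    p (∑ o, x o) ≤ ∑ o, p (x o) :=
  Finset.le_sum_of_subadditive p (map_zero p).le (map_add_le_add p) _ x

theorem abs_sum_seminorm_sub_le [AddCommGroup E] [Module ℝ E] (p : Seminorm ℝ E) (x : O → E)
    (y : E) {z : O → ℝ} (hz : ∀ o, 0 ≤ z o) (hz1 : ∑ o, z o ≤ 1) :
    |∑ o, p (x o) - ∑ o, p (x o - z o • y)| ≤ p y := by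
  calc |∑ o, p (x o) - ∑ o, p (x o - z o • y)|
      ≤ ∑ o, |p (x o) - p (x o - z o • y)| := by
        rw [← Finset.sum_sub_distrib]
        exact Finset.abs_sum_le_sum_abs _ _
    _ ≤ ∑ o, z o * p y := Finset.sum_le_sum fun o _ => by
        simpa [map_smul_eq_mul, abs_of_nonneg (hz o)] using
          abs_sub_map_le_sub p (x o) (x o - z o • y)
    _ ≤ p y := by
        rw [← Finset.sum_mul]
        exact mul_le_of_le_one_left (apply_nonneg p y) hz1

/-- The seminorm `v ↦ ∑ o, p (v * w o)`, the total size of the multiples of `v` by a family. -/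
noncomputable def mulSeminorm [Ring E] [Algebra ℝ E] (p : Seminorm ℝ E) (w : O → E) :
    Seminorm ℝ E :=
  ∑ o, p.comp (LinearMap.mulRight ℝ (w o))

theorem mulSeminorm_apply [Ring E] [Algebra ℝ E] (p : Seminorm ℝ E) (w : O → E) (v : E) :
    mulSeminorm p w v = ∑ o, p (v * w o) := by
  simp only [mulSeminorm, ← FunLike.coeAddMonoidHom_apply, map_sum, Finset.sum_apply]
  rfl

end Seminorm

/-- A history-dependent policy without a seed and without a horizon. -/
abbrev HistoryPolicy (S A R : Type*) [Fintype A] :=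
  (n : ℕ) → (Fin n → S × A × R) → S → stdSimplex ℝ A

namespace HistoryPolicy

variable {S A R : Type*} [Fintype A]

open Classical in
/-- The memoryless policy that plays the action `ψ n s` in the state `s` at time `n`. -/
noncomputable def deterministic (ψ : ℕ → S → A) : HistoryPolicy S A R :=
  fun n _ s => stdSimplex.vertex (ψ n s)

/-- The product of the probabilities that the policy `σ` gives to the actions of `T`. -/
def actionProb (σ : HistoryPolicy S A R) {n : ℕ} (T : Trajectory S A R n) : ℝ :=
  ∏ t : Fin n, σ t (T.past t) (T.state t) (T.action t)

theorem actionProb_nonneg (σ : HistoryPolicy S A R) {n : ℕ} (T : Trajectory S A R n) :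
    0 ≤ σ.actionProb T :=
  Finset.prod_nonneg fun _ _ => stdSimplex.zero_le _ _

theorem actionProb_succ (σ : HistoryPolicy S A R) {n : ℕ} (T : Trajectory S A R (n + 1)) :
    σ.actionProb T = σ.actionProb (n := n) (Fin.init T) *
      σ n (Fin.init T) (T.state (Fin.last n)) (T.action (Fin.last n)) :=
  Fin.prod_univ_castSucc _

theorem actionProb_congr {σ τ : HistoryPolicy S A R} {n : ℕ} (h : ∀ i < n, σ i = τ i)
    (T : Trajectory S A R n) : σ.actionProb T = τ.actionProb T :=
  Finset.prod_congr rfl fun t _ => by rw [h t t.isLt]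

end HistoryPolicy

/-- A controlled system whose hidden context `k : K` is fixed in advance. The number `init s k` is
the probability to start in `s` in the context `k`, and `step n s a (r, s') k` is the probability
that the action `a`, taken in `s` at time `n`, yields the reward `r` and the next state `s'`.
Nothing is normalised, so that the vectors over `K` are to be read as likelihoods. -/
structure LatentSystem (S A R K : Type*) where
  init : S → K → ℝ
  step : ℕ → S → A → R × S → K → ℝ
  step_nonneg : ∀ n s a o k, 0 ≤ step n s a o k

namespace LatentSystem

variable {S A R K : Type*}

/-- The likelihoods, in all contexts, of the path `T` followed by the state `s`. -/
def likelihood (P : LatentSystem S A R K) :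
    (n : ℕ) → Trajectory S A R n → S → K → ℝ
  | 0, _, s => P.init s
  | n + 1, T, s => P.likelihood n (Fin.init T) (T.state (Fin.last n)) *
      P.step n (T.state (Fin.last n)) (T.action (Fin.last n)) (T.rew (Fin.last n), s)

/-- Two systems side by side, as one system whose contexts are those of both. -/
def sum {K' : Type*} (P : LatentSystem S A R K) (Q : LatentSystem S A R K') :
    LatentSystem S A R (K ⊕ K') where
  init s := Sum.elim (P.init s) (Q.init s)
  step n s a o := Sum.elim (P.step n s a o) (Q.step n s a o)
  step_nonneg n s a o := Sum.rec (P.step_nonneg n s a o) (Q.step_nonneg n s a o)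

theorem likelihood_sum {K' : Type*} (P : LatentSystem S A R K) (Q : LatentSystem S A R K')
    (n : ℕ) (T : Trajectory S A R n) (s : S) :
    (P.sum Q).likelihood n T s = Sum.elim (P.likelihood n T s) (Q.likelihood n T s) := by
  induction n generalizing s with
  | zero => rfl
  | succ n ih =>
    rw [likelihood, ih]
    ext (k | k) <;> rfl

variable [Fintype S] [Fintype R]

/-- The sum of `Φ` over the outcomes of the action `a` taken in the state `s` at time `n`, after a
path with likelihoods `v`. -/
def stepSum (P : LatentSystem S A R K) (n : ℕ) (Φ : S → (K → ℝ) → ℝ) (s : S) (a : A)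
    (v : K → ℝ) : ℝ :=
  ∑ o, Φ o.2 (v * P.step n s a o)

/-- Bellman's equations: `φ` maximises, in the context `N`, the expectation of the payoff `f`
collected at time `t`, and `ρ j s k` is the expectation of that payoff under `φ` in the context `k`
when the state at time `j` is `s`. Only the values `φ j` for `j < t` and `ρ j` for `j ≤ t` carry
this meaning. -/
structure IsOptimal (P : LatentSystem S A R K) (N : K) (t : ℕ) (f : S → ℝ) (φ : ℕ → S → A)
    (ρ : ℕ → S → K → ℝ) : Prop where
  terminal : ∀ s, ρ t s = fun _ => f s
  nonneg : ∀ j s, 0 ≤ ρ j s N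
  bellman : ∀ j < t, ∀ s, ρ j s = ∑ o, P.step j s (φ j s) o * ρ (j + 1) o.2
  optimal : ∀ j < t, ∀ s a, ∑ o, P.step j s a o N * ρ (j + 1) o.2 N ≤ ρ j s N

theorem exists_isOptimal [Finite A] [Nonempty A] (P : LatentSystem S A R K) (N : K) (t : ℕ)
    {f : S → ℝ} (hf : ∀ s, 0 ≤ f s) :
    ∃ (φ : ℕ → S → A) (ρ : ℕ → S → K → ℝ), P.IsOptimal N t f φ ρ := by
  induction t generalizing P with
  | zero =>
    exact ⟨fun _ _ => Classical.arbitrary A, fun _ s _ => f s,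
      ⟨fun _ => rfl, fun _ => hf, by simp, by simp⟩⟩
  | succ t ih =>
    obtain ⟨φ, ρ, h⟩ :=
      ih ⟨P.init, fun n => P.step (n + 1), fun n => P.step_nonneg (n + 1)⟩
    choose b hb using fun s => Finite.exists_max fun a => ∑ o, P.step 0 s a o N * ρ 0 o.2 N
    let ρ₀ : S → K → ℝ := fun s => ∑ o, P.step 0 s (b s) o * ρ 0 o.2
    have hρ₀ : ∀ s, ρ₀ s N = ∑ o, P.step 0 s (b s) o N * ρ 0 o.2 N := fun s =>
      Finset.sum_apply _ _ _
    refine ⟨fun j => j.casesOn b φ, fun j => j.casesOn ρ₀ ρ, h.terminal, ?_, ?_, ?_⟩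
    · rintro (_ | j) s
      · exact (Finset.sum_nonneg fun o _ =>
          mul_nonneg (P.step_nonneg _ _ _ _ _) (h.nonneg _ _)).trans_eq (hρ₀ s).symm
      · exact h.nonneg j s
    · rintro (_ | j) hj s
      · rfl
      · exact h.bellman j (by omega) s
    · rintro (_ | j) hj s a
      · exact (hb s a).trans_eq (hρ₀ s).symm
      · exact h.optimal j (by omega) s a

section Elimination

variable {P : LatentSystem S A R K} {N : K} {t : ℕ} {f : S → ℝ} {φ : ℕ → S → A}
  {ρ : ℕ → S → K → ℝ}

/-- Doob's transform of the system in the context `N` by the values `ρ`: the weight of the outcome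
`o` when the probability of every path is tilted by the value of its last state. It is `0` where the
value vanishes, by the convention on division. -/
noncomputable def tilt (P : LatentSystem S A R K) (N : K) (ρ : ℕ → S → K → ℝ) (j : ℕ) (s : S)
    (a : A) (o : R × S) : ℝ :=
  P.step j s a o N * ρ (j + 1) o.2 N / ρ j s N

/-- What the outcome `o` adds to the predictions `ρ j s` beyond the multiple of them that is correct
in the context `N`; this eliminates the context `N`. -/
noncomputable def residual (P : LatentSystem S A R K) (N : K) (ρ : ℕ → S → K → ℝ) (j : ℕ) (s : S)
    (a : A) (o : R × S) : K → ℝ :=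
  P.step j s a o * ρ (j + 1) o.2 - P.tilt N ρ j s a o • ρ j s

theorem IsOptimal.tilt_nonneg (h : P.IsOptimal N t f φ ρ) (j : ℕ) (s : S) (a : A) (o : R × S) :
    0 ≤ P.tilt N ρ j s a o :=
  div_nonneg (mul_nonneg (P.step_nonneg _ _ _ _ _) (h.nonneg _ _)) (h.nonneg _ _)

theorem IsOptimal.sum_tilt_le_one (h : P.IsOptimal N t f φ ρ) {j : ℕ} (hj : j < t) (s : S)
    (a : A) : ∑ o, P.tilt N ρ j s a o ≤ 1 := by
  simp only [tilt, ← Finset.sum_div]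
  exact div_le_one_of_le₀ (h.optimal j hj s a) (h.nonneg _ _)

theorem IsOptimal.residual_apply_eq_zero (h : P.IsOptimal N t f φ ρ) {j : ℕ} (hj : j < t) (s : S)
    (a : A) (o : R × S) : P.residual N ρ j s a o N = 0 := by
  have hnonneg : ∀ o ∈ Finset.univ, 0 ≤ P.step j s a o N * ρ (j + 1) o.2 N := fun o _ =>
    mul_nonneg (P.step_nonneg _ _ _ _ _) (h.nonneg _ _)
  have hle : P.step j s a o N * ρ (j + 1) o.2 N ≤ ρ j s N :=
    (Finset.single_le_sum hnonneg (Finset.mem_univ o)).trans (h.optimal j hj s a)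
  change P.step j s a o N * ρ (j + 1) o.2 N - P.tilt N ρ j s a o * ρ j s N = 0
  by_cases h0 : ρ j s N = 0
  · rw [le_antisymm (hle.trans_eq h0) (hnonneg o (Finset.mem_univ o)), h0, mul_zero, sub_zero]
  · rw [tilt, div_mul_cancel₀ _ h0, sub_self]

theorem IsOptimal.abs_stepSum_sub_mulSeminorm_residual_le (h : P.IsOptimal N t f φ ρ)
    (p : Seminorm ℝ (K → ℝ)) {j : ℕ} (hj : j < t) (s : S) (a : A) (v : K → ℝ) :
    |P.stepSum j (fun s v => p (v * ρ (j + 1) s)) s a v - mulSeminorm p (P.residual N ρ j s a) v|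
      ≤ p (v * ρ j s) := by
  simpa only [stepSum, mulSeminorm_apply, residual, mul_sub, mul_smul_comm, mul_assoc] using
    abs_sum_seminorm_sub_le p (fun o => v * (P.step j s a o * ρ (j + 1) o.2)) (v * ρ j s)
      (h.tilt_nonneg j s a) (h.sum_tilt_le_one hj s a)

theorem IsOptimal.seminorm_mul_terminal (h : P.IsOptimal N t f φ ρ) (hf : ∀ s, 0 ≤ f s)
    (p : Seminorm ℝ (K → ℝ)) (s : S) (v : K → ℝ) : p (v * ρ t s) = f s * p v := by
  have hv : v * ρ t s = f s • v := by
    ext k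
    simp [h.terminal, mul_comm]
  rw [hv, map_smul_eq_mul, Real.norm_of_nonneg (hf s)]

/-- The total size of the residuals of the action `i.2`, collected on the paths that end in the
state `i.1`. -/
noncomputable def residualSize (P : LatentSystem S A R K) (p : Seminorm ℝ (K → ℝ)) (N : K)
    (ρ : ℕ → S → K → ℝ) (j : ℕ) (i : S × A) (s : S) (v : K → ℝ) : ℝ :=
  ({i.1} : Set S).indicator 1 s * mulSeminorm p (P.residual N ρ j i.1 i.2) v

theorem residualSize_nonneg (p : Seminorm ℝ (K → ℝ)) (j : ℕ) (i : S × A) (s : S) (v : K → ℝ) :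
    0 ≤ P.residualSize p N ρ j i s v :=
  mul_nonneg (Set.indicator_nonneg (fun _ _ => zero_le_one) s) (apply_nonneg _ v)

end Elimination

variable [Fintype A]

/-- The sum, over all paths of `n` steps under the policy `σ`, of `Φ` at the last state and the
vector of likelihoods of the path. -/
def pathSum (P : LatentSystem S A R K) (σ : HistoryPolicy S A R) (n : ℕ)
    (Φ : S → (K → ℝ) → ℝ) : ℝ :=
  ∑ T : Trajectory S A R n, ∑ s, σ.actionProb T * Φ s (P.likelihood n T s)

section PathSum

variable {P : LatentSystem S A R K} {σ : HistoryPolicy S A R} {n : ℕ} {Φ Ψ : S → (K → ℝ) → ℝ}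

theorem pathSum_nonneg (h : ∀ s v, 0 ≤ Φ s v) : 0 ≤ P.pathSum σ n Φ :=
  Finset.sum_nonneg fun T _ => Finset.sum_nonneg fun _ _ =>
    mul_nonneg (σ.actionProb_nonneg T) (h _ _)

theorem pathSum_mono (h : ∀ s v, Φ s v ≤ Ψ s v) : P.pathSum σ n Φ ≤ P.pathSum σ n Ψ :=
  Finset.sum_le_sum fun T _ => Finset.sum_le_sum fun _ _ =>
    mul_le_mul_of_nonneg_left (h _ _) (σ.actionProb_nonneg T)

theorem pathSum_add : P.pathSum σ n (fun s v => Φ s v + Ψ s v) =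
    P.pathSum σ n Φ + P.pathSum σ n Ψ := by
  simp only [pathSum, mul_add, Finset.sum_add_distrib]

theorem pathSum_sum {ι : Type*} (I : Finset ι) (Φ : ι → S → (K → ℝ) → ℝ) :
    P.pathSum σ n (fun s v => ∑ i ∈ I, Φ i s v) = ∑ i ∈ I, P.pathSum σ n (Φ i) := by
  simp only [pathSum, Finset.mul_sum]
  rw [Finset.sum_comm (s := I)]
  exact Finset.sum_congr rfl fun T _ => Finset.sum_comm

theorem pathSum_congr {τ : HistoryPolicy S A R} (h : ∀ i < n, σ i = τ i) :
    P.pathSum σ n Φ = P.pathSum τ n Φ := by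
  simp only [pathSum, HistoryPolicy.actionProb_congr h]

theorem pathSum_deterministic_congr {ψ ψ' : ℕ → S → A} (h : ∀ i < n, ψ i = ψ' i) :
    P.pathSum (.deterministic ψ) n Φ = P.pathSum (.deterministic ψ') n Φ :=
  pathSum_congr fun i hi => by
    funext T s
    simp only [HistoryPolicy.deterministic, h i hi]

theorem pathSum_succ : P.pathSum σ (n + 1) Φ =
    ∑ T : Trajectory S A R n, ∑ s, σ.actionProb T *
      ∑ a, σ n T s a * P.stepSum n Φ s a (P.likelihood n T s) := by
  simp only [pathSum, sum_eq_sum_snoc, stepSum, HistoryPolicy.actionProb_succ, likelihood,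
    Trajectory.state, Trajectory.action, Trajectory.rew, Fin.init_snoc, Fin.snoc_last,
    Fintype.sum_prod_type, Finset.mul_sum, mul_assoc]

theorem pathSum_succ_le (h : ∀ T s a,
    P.stepSum n Φ s a (P.likelihood n T s) ≤ Ψ s (P.likelihood n T s)) :
    P.pathSum σ (n + 1) Φ ≤ P.pathSum σ n Ψ := by
  rw [pathSum_succ]
  refine Finset.sum_le_sum fun T _ => Finset.sum_le_sum fun s _ =>
    mul_le_mul_of_nonneg_left ?_ (σ.actionProb_nonneg T)
  calc ∑ a, σ n T s a * P.stepSum n Φ s a (P.likelihood n T s)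
      ≤ ∑ a, σ n T s a * Ψ s (P.likelihood n T s) := by
        gcongr with a
        · exact stdSimplex.zero_le _ _
        · exact h T s a
    _ = Ψ s (P.likelihood n T s) := by
        rw [← Finset.sum_mul, stdSimplex.sum_eq_one, one_mul]

theorem pathSum_deterministic_succ {ψ : ℕ → S → A} :
    P.pathSum (.deterministic ψ) (n + 1) Φ =
      P.pathSum (.deterministic ψ) n fun s v => P.stepSum n Φ s (ψ n s) v := by
  classical
  rw [pathSum_succ, pathSum]
  simp [HistoryPolicy.deterministic, Pi.single_apply]

theorem exists_pathSum_one_le [Nonempty A] (P : LatentSystem S A R K) (Φ : S → (K → ℝ) → ℝ) :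
    ∃ ψ : ℕ → S → A, ∀ σ, P.pathSum σ 1 Φ ≤ P.pathSum (.deterministic ψ) 1 Φ := by
  choose b hb using fun s => Finite.exists_max fun a => P.stepSum 0 Φ s a (P.init s)
  refine ⟨fun _ => b, fun σ => ?_⟩
  rw [pathSum_deterministic_succ]
  calc P.pathSum σ 1 Φ ≤ P.pathSum σ 0 fun s v => P.stepSum 0 Φ s (b s) v :=
        pathSum_succ_le fun _ s a => hb s a
    _ = P.pathSum (.deterministic fun _ => b) 0 fun s v => P.stepSum 0 Φ s (b s) v :=
        pathSum_congr fun _ hi => absurd hi (Nat.not_lt_zero _)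

end PathSum

section Elimination

variable {P : LatentSystem S A R K} {N : K} {t : ℕ} {f : S → ℝ} {φ : ℕ → S → A}
  {ρ : ℕ → S → K → ℝ} {p : Seminorm ℝ (K → ℝ)} {E : ℝ}

theorem IsOptimal.pathSum_deterministic_le (h : P.IsOptimal N t f φ ρ)
    (hE : ∀ ψ : ℕ → S → A, P.pathSum (.deterministic ψ) t (fun s v => p (v * ρ t s)) ≤ E)
    {j : ℕ} (hj : j ≤ t) (ψ : ℕ → S → A) :
    P.pathSum (.deterministic ψ) j (fun s v => p (v * ρ j s)) ≤ E := by
  induction hj using Nat.decreasingInduction generalizing ψ with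
  | self => exact hE ψ
  | of_succ j hj ih =>
    let ψ' : ℕ → S → A := fun i => if i = j then φ j else ψ i
    calc P.pathSum (.deterministic ψ) j (fun s v => p (v * ρ j s))
        = P.pathSum (.deterministic ψ') j (fun s v => p (v * ρ j s)) :=
          pathSum_deterministic_congr fun i hi => (if_neg hi.ne).symm
      _ ≤ P.pathSum (.deterministic ψ') j fun s v =>
            P.stepSum j (fun s v => p (v * ρ (j + 1) s)) s (ψ' j s) v :=
          pathSum_mono fun s v => by
            simpa [h.bellman j hj, Finset.mul_sum, stepSum, mul_assoc, ψ'] using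
              seminorm_sum_le p fun o => v * (P.step j s (φ j s) o * ρ (j + 1) o.2)
      _ = P.pathSum (.deterministic ψ') (j + 1) (fun s v => p (v * ρ (j + 1) s)) :=
          pathSum_deterministic_succ.symm
      _ ≤ E := ih ψ'

theorem IsOptimal.pathSum_deterministic_residualSize_le (h : P.IsOptimal N t f φ ρ)
    (hE : ∀ ψ : ℕ → S → A, P.pathSum (.deterministic ψ) t (fun s v => p (v * ρ t s)) ≤ E)
    {j : ℕ} (hj : j < t) (i : S × A) (ψ : ℕ → S → A) :
    P.pathSum (.deterministic ψ) j (P.residualSize p N ρ j i) ≤ 2 * E := by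
  let ψ' : ℕ → S → A := fun n => if n = j then fun _ => i.2 else ψ n
  let Φ : ℕ → S → (K → ℝ) → ℝ := fun n s v => p (v * ρ n s)
  have hresidual : ∀ s v, P.residualSize p N ρ j i s v ≤
      P.stepSum j (Φ (j + 1)) s (ψ' j s) v + Φ j s v := fun s v => by
    by_cases hs : s = i.1
    · subst hs
      have := abs_le.1 (h.abs_stepSum_sub_mulSeminorm_residual_le p hj i.1 i.2 v)
      simp only [residualSize, Set.indicator_of_mem (Set.mem_singleton _), Pi.one_apply, one_mul,
        ψ', if_true]
      linarith [this.1]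
    · simp only [residualSize, Set.indicator_of_notMem (Set.notMem_singleton_iff.2 hs), zero_mul]
      exact add_nonneg (Finset.sum_nonneg fun o _ => apply_nonneg p _) (apply_nonneg p _)
  calc P.pathSum (.deterministic ψ) j (P.residualSize p N ρ j i)
      = P.pathSum (.deterministic ψ') j (P.residualSize p N ρ j i) :=
        pathSum_deterministic_congr fun n hn => (if_neg hn.ne).symm
    _ ≤ P.pathSum (.deterministic ψ') j fun s v =>
          P.stepSum j (Φ (j + 1)) s (ψ' j s) v + Φ j s v := pathSum_mono hresidual
    _ = P.pathSum (.deterministic ψ') (j + 1) (Φ (j + 1)) +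
          P.pathSum (.deterministic ψ') j (Φ j) := by
        rw [pathSum_add, pathSum_deterministic_succ]
    _ ≤ E + E := add_le_add (h.pathSum_deterministic_le hE hj ψ')
        (h.pathSum_deterministic_le hE hj.le ψ')
    _ = 2 * E := (two_mul E).symm

theorem IsOptimal.pathSum_succ_le (h : P.IsOptimal N t f φ ρ) {j : ℕ} (hj : j < t)
    (σ : HistoryPolicy S A R) :
    P.pathSum σ (j + 1) (fun s v => p (v * ρ (j + 1) s)) ≤
      P.pathSum σ j (fun s v => p (v * ρ j s)) +
        ∑ i : S × A, P.pathSum σ j (P.residualSize p N ρ j i) := by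
  rw [← pathSum_sum, ← pathSum_add]
  refine LatentSystem.pathSum_succ_le fun T s a => ?_
  set v := P.likelihood j T s
  have hstep := (abs_le.1 (h.abs_stepSum_sub_mulSeminorm_residual_le p hj s a v)).2
  have hsingle : mulSeminorm p (P.residual N ρ j s a) v ≤
      ∑ i : S × A, P.residualSize p N ρ j i s v := by
    simpa [residualSize] using Finset.single_le_sum
      (fun i _ => residualSize_nonneg p j i s v) (Finset.mem_univ (s, a))
  linarith

theorem IsOptimal.pathSum_le [Nonempty A] (h : P.IsOptimal N t f φ ρ)
    (hE : ∀ ψ : ℕ → S → A, P.pathSum (.deterministic ψ) t (fun s v => p (v * ρ t s)) ≤ E)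
    (σ : HistoryPolicy S A R) {B : ℝ}
    (hB : ∀ j, j + 1 < t → ∀ i, P.pathSum σ (j + 1) (P.residualSize p N ρ (j + 1) i) ≤ B)
    {j : ℕ} (hj : j + 1 ≤ t) :
    P.pathSum σ (j + 1) (fun s v => p (v * ρ (j + 1) s)) ≤
      E + j * (Fintype.card S * Fintype.card A * B) := by
  induction j with
  | zero =>
    obtain ⟨ψ, hψ⟩ := exists_pathSum_one_le P fun s v => p (v * ρ 1 s)
    simpa using (hψ σ).trans (h.pathSum_deterministic_le hE hj ψ)
  | succ j ih =>
    calc P.pathSum σ (j + 2) (fun s v => p (v * ρ (j + 2) s))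
        ≤ P.pathSum σ (j + 1) (fun s v => p (v * ρ (j + 1) s)) +
            ∑ i : S × A, P.pathSum σ (j + 1) (P.residualSize p N ρ (j + 1) i) :=
          h.pathSum_succ_le hj σ
      _ ≤ (E + j * (Fintype.card S * Fintype.card A * B)) + ∑ _i : S × A, B :=
          add_le_add (ih (by omega)) (Finset.sum_le_sum fun i _ => hB j hj i)
      _ = E + (j + 1 : ℕ) * (Fintype.card S * Fintype.card A * B) := by
          simp only [Finset.sum_const, Finset.card_univ, Fintype.card_prod, nsmul_eq_mul]
          push_cast
          ring

end Elimination

theorem pathSum_le_of_deterministic [Nonempty A] (P : LatentSystem S A R K) (h : ℕ)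
    (C : Finset K) {p : Seminorm ℝ (K → ℝ)} (hp : ∀ v, (∀ k ∈ C, v k = 0) → p v = 0) {t : ℕ}
    (ht : t ≤ h) {f : S → ℝ} (hf : ∀ s, 0 ≤ f s) {E : ℝ}
    (hE : ∀ ψ : ℕ → S → A, P.pathSum (.deterministic ψ) (t + 1) (fun s v => f s * p v) ≤ E)
    (σ : HistoryPolicy S A R) :
    P.pathSum σ (t + 1) (fun s v => f s * p v) ≤
      (∑ n ∈ Finset.range C.card, (2 * h * Fintype.card S * Fintype.card A : ℝ) ^ n) * E := by
  classical
  induction C using Finset.induction_on generalizing p t f E with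
  | empty =>
    have hp0 : ∀ v, p v = 0 := fun v => hp v (by simp)
    simp [hp0, pathSum]
  | insert N C hN ih =>
    set x : ℝ := 2 * h * Fintype.card S * Fintype.card A with hx
    set G : ℝ := ∑ n ∈ Finset.range C.card, x ^ n
    have hE0 : 0 ≤ E := (pathSum_nonneg fun s v => mul_nonneg (hf s) (apply_nonneg p v)).trans
      (hE fun _ _ => Classical.arbitrary A)
    have : 0 ≤ G := Finset.sum_nonneg fun n _ => by positivity
    obtain ⟨φ, ρ, hopt⟩ := P.exists_isOptimal N (t + 1) hf
    simp only [← hopt.seminorm_mul_terminal hf] at hE ⊢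
    have hresidual : ∀ j, j + 1 < t + 1 → ∀ i : S × A,
        P.pathSum σ (j + 1) (P.residualSize p N ρ (j + 1) i) ≤ G * (2 * E) := fun j hj i => by
      refine ih (fun v hv => ?_) (by omega) (Set.indicator_nonneg fun _ _ => zero_le_one)
        (hopt.pathSum_deterministic_residualSize_le hE hj i)
      rw [mulSeminorm_apply]
      refine Finset.sum_eq_zero fun o _ => hp _ fun k hk => ?_
      obtain rfl | hk := Finset.mem_insert.1 hk
      · rw [Pi.mul_apply, hopt.residual_apply_eq_zero hj, mul_zero]
      · rw [Pi.mul_apply, hv k hk, zero_mul]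
    calc P.pathSum σ (t + 1) (fun s v => p (v * ρ (t + 1) s))
        ≤ E + t * (Fintype.card S * Fintype.card A * (G * (2 * E))) :=
          hopt.pathSum_le hE σ hresidual le_rfl
      _ ≤ E + h * (Fintype.card S * Fintype.card A * (G * (2 * E))) := by gcongr
      _ = (x * G + 1) * E := by rw [hx]; ring
      _ = (∑ n ∈ Finset.range (insert N C).card, x ^ n) * E := by
          rw [Finset.card_insert_of_notMem hN, geom_sum_succ]

end LatentSystem

namespace Policy

variable {Ξ S A R : Type*} [MeasurableSpace Ξ] [Fintype A] {H : ℕ}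

open Classical in
/-- The policy `π` with the seed `ξ`, continued by a fixed action after the horizon. -/
noncomputable def history [Nonempty A] (π : Policy Ξ S A R H) (ξ : Ξ) : HistoryPolicy S A R :=
  fun n T s =>
    if h : n < H then π.act ξ ⟨n, h⟩ T s else stdSimplex.vertex (Classical.arbitrary A)

theorem actionProb_history [Nonempty A] (π : Policy Ξ S A R H) (ξ : Ξ) (T : Trajectory S A R H) :
    (π.history ξ).actionProb T = ∏ t, π.act ξ t (T.past t) (T.state t) (T.action t) :=
  Finset.prod_congr rfl fun t _ => by rw [history, dif_pos t.isLt]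

theorem integrable_prod_act (π : Policy Ξ S A R H) (T : Trajectory S A R H) :
    Integrable (fun ξ => ∏ t, π.act ξ t (T.past t) (T.state t) (T.action t))
      (π.seed : Measure Ξ) := by
  refine .of_bound (Finset.measurable_fun_prod _ fun t _ =>
    π.measurable_act _ _ _ _).aestronglyMeasurable 1 (.of_forall fun ξ => ?_)
  rw [Real.norm_eq_abs, Finset.abs_prod]
  exact Finset.prod_le_one (fun t _ => abs_nonneg _) fun t _ => by
    rw [abs_of_nonneg (stdSimplex.zero_le _ _)]
    exact stdSimplex.le_one _ _

end Policy

open Classical in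
/-- The memoryless policy that plays the action `ψ t s` in the state `s` at time `t`. -/
noncomputable def MemorylessPolicy.deterministic {S A : Type*} [Fintype A] {H : ℕ}
    (ψ : Fin H → S → A) : MemorylessPolicy S A H :=
  fun t s => stdSimplex.vertex (ψ t s)

theorem MemorylessPolicy.history_deterministic {S A R : Type*} [Fintype A] [Nonempty A] {H : ℕ}
    (ψ : ℕ → S → A) {n : ℕ} (hn : n < H) (ξ : Unit) :
    ((deterministic fun t : Fin H => ψ t).toPolicy R).history ξ n =
      HistoryPolicy.deterministic ψ n := by
  funext T s
  rw [Policy.history, dif_pos hn]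
  rfl

theorem tvDist_nonneg {X : Type*} [Fintype X] (p q : X → ℝ) : 0 ≤ tvDist p q :=
  mul_nonneg (by norm_num) (Finset.sum_nonneg fun _ _ => abs_nonneg _)

namespace LMDP

variable {S A R : Type*} [Fintype S] [Fintype R] {M M₁ M₂ H : ℕ}

/-- The probability of the states and rewards of `T` in the context `m` when the actions of `T` are
played. -/
def envProb (θ : LMDP S A R M) (m : Fin M) (T : Trajectory S A R H) : ℝ :=
  ∏ t, (θ.stateProb m T t * θ.reward m (T.state t) (T.action t) (T.rew t))

/-- The mixture of `envProb` over the contexts. -/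
def mixProb (θ : LMDP S A R M) (T : Trajectory S A R H) : ℝ :=
  ∑ m, θ.weight m * θ.envProb m T

theorem stateProb_castSucc (θ : LMDP S A R M) (m : Fin M) (T : Trajectory S A R (H + 1))
    (t : Fin H) : θ.stateProb m T t.castSucc = θ.stateProb (H := H) m (Fin.init T) t := by
  obtain ⟨_ | t, ht⟩ := t <;> rfl

theorem envProb_succ (θ : LMDP S A R M) (m : Fin M) (T : Trajectory S A R (H + 1)) :
    θ.envProb m T = θ.envProb (H := H) m (Fin.init T) * (θ.stateProb m T (Fin.last H) *
      θ.reward m (T.state (Fin.last H)) (T.action (Fin.last H)) (T.rew (Fin.last H))) := by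
  simp only [envProb, Fin.prod_univ_castSucc, stateProb_castSucc]
  rfl

open Classical in
/-- The distribution of the state after time `n`. The last step of an episode keeps its state, so
that the system after `H` steps carries no randomness beyond the trajectory. -/
noncomputable def nextState (θ : LMDP S A R M) (H n : ℕ) (m : Fin M) (s : S) (a : A) :
    stdSimplex ℝ S :=
  if n + 1 < H then θ.trans m s a else stdSimplex.vertex s

/-- The episodes of horizon `H` of `θ`, as a latent system. -/
noncomputable def system (θ : LMDP S A R M) (H : ℕ) : LatentSystem S A R (Fin M) where
  init s m := θ.init m s
  step n s a o m := θ.reward m s a o.1 * θ.nextState H n m s a o.2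
  step_nonneg _ _ _ _ _ := mul_nonneg (stdSimplex.zero_le _ _) (stdSimplex.zero_le _ _)

theorem likelihood_system_succ (θ : LMDP S A R M) (m : Fin M) {n : ℕ} (hn : n < H)
    (T : Trajectory S A R (n + 1)) (s : S) :
    (θ.system H).likelihood (n + 1) T s m = θ.envProb m T *
      θ.nextState H n m (T.state (Fin.last n)) (T.action (Fin.last n)) s := by
  induction n generalizing s with
  | zero =>
    simp only [envProb, Fin.prod_univ_succ, Finset.univ_eq_empty, Finset.prod_empty, mul_one,
      mul_assoc]
    rfl
  | succ n ih =>
    rw [LatentSystem.likelihood, Pi.mul_apply, ih (by omega), envProb_succ θ m T, nextState,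
      if_pos hn]
    simp only [mul_assoc]
    rfl

/-- The systems of two models side by side, for episodes of the same horizon. -/
noncomputable abbrev jointSystem (θ₁ : LMDP S A R M₁) (θ₂ : LMDP S A R M₂) (H : ℕ) :
    LatentSystem S A R (Fin M₁ ⊕ Fin M₂) :=
  (θ₁.system H).sum (θ₂.system H)

open Classical in
theorem likelihood_jointSystem_horizon (θ₁ : LMDP S A R M₁) (θ₂ : LMDP S A R M₂)
    (T : Trajectory S A R (H + 1)) (s : S) :
    (jointSystem θ₁ θ₂ (H + 1)).likelihood (H + 1) T s =
      (if s = T.state (Fin.last H) then 1 else 0 : ℝ) •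
        Sum.elim (fun m => θ₁.envProb m T) fun m => θ₂.envProb m T := by
  rw [LatentSystem.likelihood_sum]
  ext (m | m) <;>
    simp [likelihood_system_succ, nextState, Pi.single_apply]

/-- The difference between the mixtures, by the weights of `θ₁` and of `θ₂`, of a vector over the
contexts of both, in absolute value. -/
noncomputable def contrast (θ₁ : LMDP S A R M₁) (θ₂ : LMDP S A R M₂) :
    Seminorm ℝ (Fin M₁ ⊕ Fin M₂ → ℝ) :=
  (normSeminorm ℝ ℝ).comp
    (Fintype.linearCombination ℝ (Sum.elim θ₁.weight fun m => -θ₂.weight m))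

theorem contrast_elim (θ₁ : LMDP S A R M₁) (θ₂ : LMDP S A R M₂) (u : Fin M₁ → ℝ)
    (v : Fin M₂ → ℝ) :
    contrast θ₁ θ₂ (Sum.elim u v) = |∑ m, θ₁.weight m * u m - ∑ m, θ₂.weight m * v m| := by
  simp [contrast, Fintype.linearCombination_apply, mul_comm, sub_eq_add_neg]

theorem contexts_pos (θ : LMDP S A R M) : 0 < M :=
  Fin.pos_iff_nonempty.2 (nonempty_of_stdSimplex θ.weight)

theorem nonempty_state (θ : LMDP S A R M) : Nonempty S :=
  nonempty_of_stdSimplex (θ.init ⟨0, θ.contexts_pos⟩)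

variable [Fintype A]

theorem pathSum_contrast (θ₁ : LMDP S A R M₁) (θ₂ : LMDP S A R M₂) (σ : HistoryPolicy S A R) :
    (jointSystem θ₁ θ₂ (H + 1)).pathSum σ (H + 1) (fun _ => contrast θ₁ θ₂) =
      ∑ T : Trajectory S A R (H + 1), σ.actionProb T * |θ₁.mixProb T - θ₂.mixProb T| := by
  classical
  simp [LatentSystem.pathSum, likelihood_jointSystem_horizon, contrast_elim, mixProb,
    apply_ite]

variable {Ξ : Type*} [MeasurableSpace Ξ]

theorem trajProb_eq (θ : LMDP S A R M) (π : Policy Ξ S A R H) (T : Trajectory S A R H) :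
    θ.trajProb π T =
      (∫ ξ, ∏ t, π.act ξ t (T.past t) (T.state t) (T.action t) ∂(π.seed : Measure Ξ)) *
        θ.mixProb T := by
  rw [trajProb, mixProb, Finset.mul_sum]
  refine Finset.sum_congr rfl fun m _ => ?_
  rw [mul_left_comm, ← integral_mul_const]
  simp only [envProb, ← Finset.prod_mul_distrib, mul_left_comm, mul_assoc]

theorem two_mul_tvDist_trajProb [Nonempty A] (θ₁ : LMDP S A R M₁) (θ₂ : LMDP S A R M₂)
    (π : Policy Ξ S A R (H + 1)) :
    2 * tvDist (θ₁.trajProb π) (θ₂.trajProb π) =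
      ∫ ξ, (jointSystem θ₁ θ₂ (H + 1)).pathSum (π.history ξ) (H + 1)
        (fun _ => contrast θ₁ θ₂) ∂(π.seed : Measure Ξ) := by
  simp only [pathSum_contrast, Policy.actionProb_history]
  rw [integral_finsetSum _ fun T _ => (π.integrable_prod_act T).mul_const _, tvDist, ← mul_assoc,
    mul_one_div_cancel two_ne_zero, one_mul]
  refine Finset.sum_congr rfl fun T _ => ?_
  rw [trajProb_eq, trajProb_eq, ← mul_sub, abs_mul, integral_mul_const, abs_of_nonneg]
  exact integral_nonneg fun ξ => Finset.prod_nonneg fun t _ => stdSimplex.zero_le _ _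

theorem two_mul_tvDist_trajProb_deterministic [Nonempty A] (θ₁ : LMDP S A R M₁)
    (θ₂ : LMDP S A R M₂) (ψ : ℕ → S → A) :
    2 * tvDist
        (θ₁.trajProb ((MemorylessPolicy.deterministic fun t : Fin (H + 1) => ψ t).toPolicy R))
        (θ₂.trajProb ((MemorylessPolicy.deterministic fun t : Fin (H + 1) => ψ t).toPolicy R)) =
      (jointSystem θ₁ θ₂ (H + 1)).pathSum (.deterministic ψ) (H + 1)
        (fun _ => contrast θ₁ θ₂) := by
  rw [two_mul_tvDist_trajProb, MemorylessPolicy.toPolicy]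
  refine (integral_dirac _ _).trans ?_
  exact LatentSystem.pathSum_congr fun n hn => MemorylessPolicy.history_deterministic ψ hn ()

theorem two_mul_tvDist_trajProb_le [Nonempty A] (θ₁ : LMDP S A R M₁) (θ₂ : LMDP S A R M₂) {ε : ℝ}
    (hε : ∀ ψ : Fin (H + 1) → S → A,
      tvDist (θ₁.trajProb ((MemorylessPolicy.deterministic ψ).toPolicy R))
        (θ₂.trajProb ((MemorylessPolicy.deterministic ψ).toPolicy R)) ≤ ε)
    (π : Policy Ξ S A R (H + 1)) :
    2 * tvDist (θ₁.trajProb π) (θ₂.trajProb π) ≤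
      (∑ n ∈ Finset.range (M₁ + M₂), (2 * H * Fintype.card S * Fintype.card A : ℝ) ^ n) *
        (2 * ε) := by
  have hp : ∀ v, (∀ k ∈ Finset.univ, v k = 0) → contrast θ₁ θ₂ v = 0 := fun v hv => by
    rw [show v = 0 from funext fun k => hv k (Finset.mem_univ k), map_zero]
  have hE : ∀ ψ : ℕ → S → A, (jointSystem θ₁ θ₂ (H + 1)).pathSum (.deterministic ψ) (H + 1)
      (fun _ v => 1 * contrast θ₁ θ₂ v) ≤ 2 * ε := fun ψ => by
    simpa only [one_mul, ← two_mul_tvDist_trajProb_deterministic] using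
      mul_le_mul_of_nonneg_left (hε fun t => ψ t) zero_le_two
  have hpath := LatentSystem.pathSum_le_of_deterministic (jointSystem θ₁ θ₂ (H + 1)) H
    Finset.univ hp le_rfl (fun _ => zero_le_one) hE
  simp only [one_mul, Finset.card_univ, Fintype.card_sum, Fintype.card_fin] at hpath
  rw [two_mul_tvDist_trajProb]
  refine (integral_mono_of_nonneg
    (.of_forall fun ξ => LatentSystem.pathSum_nonneg fun _ => apply_nonneg _)
    (integrable_const _) (.of_forall fun ξ => hpath (π.history ξ))).trans_eq ?_
  rw [integral_const, probReal_univ, one_smul]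

end LMDP

theorem lemma4_general {Ξ S A R : Type*} [MeasurableSpace Ξ] [Fintype S] [Fintype A] [Fintype R]
    {M₁ M₂ H : ℕ} (θ₁ : LMDP S A R M₁) (θ₂ : LMDP S A R M₂) (ε : ℝ)
    (hε : ∀ ψ : Fin H → S → A,
      tvDist (θ₁.trajProb ((MemorylessPolicy.deterministic ψ).toPolicy R))
        (θ₂.trajProb ((MemorylessPolicy.deterministic ψ).toPolicy R)) ≤ ε)
    (π : Policy Ξ S A R H) :
    tvDist (θ₁.trajProb π) (θ₂.trajProb π) ≤
      (2 * H * Fintype.card S * Fintype.card A : ℝ) ^ (M₁ + M₂ - 1) * ε := by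
  have := θ₁.nonempty_state
  have hM₁ := θ₁.contexts_pos
  have hM₂ := θ₂.contexts_pos
  have hexp : M₁ + M₂ - 1 ≠ 0 := by omega
  obtain _ | h := H
  · simp [tvDist, LMDP.trajProb, hexp]
  obtain _ | _ := isEmpty_or_nonempty A
  · simp [tvDist, hexp]
  have hε0 : 0 ≤ ε := (tvDist_nonneg _ _).trans (hε fun _ _ => Classical.arbitrary A)
  have hSA : (1 : ℝ) ≤ Fintype.card S * Fintype.card A := by
    exact_mod_cast Nat.mul_pos (Fintype.card_pos (α := S)) (Fintype.card_pos (α := A))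
  have htv := LMDP.two_mul_tvDist_trajProb_le θ₁ θ₂ hε π
  have hgeom : ∑ n ∈ Finset.range (M₁ + M₂), (2 * h * Fintype.card S * Fintype.card A : ℝ) ^ n ≤
      (2 * (h + 1 : ℕ) * Fintype.card S * Fintype.card A : ℝ) ^ (M₁ + M₂ - 1) := by
    rw [← Nat.sub_add_cancel (Nat.add_pos_left hM₁ M₂), Nat.add_sub_cancel]
    refine (geom_sum_le_one_add_pow (by positivity) _).trans (pow_le_pow_left₀ (by positivity) ?_ _)
    push_cast
    linarith
  linarith [mul_le_mul_of_nonneg_right hgeom hε0]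

/-- `M` is positive whenever an `LMDP S A R M` exists, as the weights add up to one; so the natural
subtraction in the exponent `d = 2 * M - 1` never truncates. -/
theorem lemma4 {Ξ S A R : Type*} [MeasurableSpace Ξ] [Fintype S] [Fintype A] [Fintype R]
    (M H : ℕ) (hH : 2 * M < H) (θ₁ θ₂ : LMDP S A R M) (ε : ℝ)
    (hε : ∀ ψ : MemorylessPolicy S A H,
      tvDist (θ₁.trajProb (ψ.toPolicy R)) (θ₂.trajProb (ψ.toPolicy R)) ≤ ε)
    (π : Policy Ξ S A R H) :
    tvDist (θ₁.trajProb π) (θ₂.trajProb π) ≤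
      (M : ℝ) * (2 * (H : ℝ) ^ 2) ^ (2 * M - 1) *
        ((M : ℝ) * (Fintype.card S : ℝ) * (Fintype.card A : ℝ)) ^ (2 * M - 1) * ε := by
  rw [two_mul M]
  exact le_mul_pow_mul_pow_mul_of_le_pow_mul (tvDist_nonneg _ _)
    (Nat.one_le_cast.2 θ₁.contexts_pos) (Nat.one_le_cast.2 (Nat.zero_lt_of_lt hH))
    (lemma4_general θ₁ θ₂ ε (fun ψ => hε (.deterministic ψ)) π)
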